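/- Let $\Xi$ be a locally compact (Hausdorff) abelian group and $m:\Xi\times\Xi\to S^1$ a separately continuous Heisenberg multiplier: $m(x+y,z)m(x,y)=m(x,y+z)m(y,z)$, $m(x,0)=m(0,x)=1$, and $x\mapsto \sigma(x,\cdot)$, where $\sigma(x,y)=m(x,y)/m(y,x)$, is a topological isomorphism of $\Xi$ onto its Pontryagin dual $\widehat\Xi$. Assume also $m(-x,-y)=m(x,y)$ for all $x,y\in\Xi$. Let $(U_x)_{x\in\Xi}$ be an irreducible projective unitary representation of $\Xi$ with multiplier $m$ on a complex Hilbert space $\mathcal H$, i.e. $U_xU_y=m(x,y)U_{x+y}$ with measurable coefficients $x\mapsto\langle U_x\varphi,\psi\rangle$, and assume that it is square integrable, i.e. $x\mapsto\langle U_x\varphi,\psi\rangle$ lies in $L^2(\Xi)$ for some $\varphi,\psi\neq0$. Let $\mathrm dx$ be the Haar measure of $\Xi$ normalized so that $\int_\Xi|\langle U_x\varphi,\psi\rangle|^2\,\mathrm dx=\|\varphi\|^2\|\psi\|^2$ (by Godement's orthogonality relations this holds for all $\varphi,\psi\in\mathcal H$ as soon as it holds for one pair of nonzero vectors). Let $R$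 be a unitary operator on $\mathcal H$ with $U_xR=RU_{-x}$ for all $x\in\Xi$. For bounded operators $B$ on $\mathcal H$ put $\alpha_x(B)=U_xBU_x^*$ and $\beta_-(B)=RBR^*$. Let $\mathcal T^1(\mathcal H)$ denote the trace class, with trace norm $\|A\|_{\mathcal T^1}=\operatorname{tr}|A|$. Then for all $A,B\in\mathcal T^1(\mathcal H)$ the operators $A\,\alpha_x(\beta_-(B))$, $x\in\Xi$, are of trace class, and the function $$A*B:\Xi\to\mathbb C,\qquad A*B(x)=\operatorname{tr}\bigl(A\,\alpha_x(\beta_-(B))\bigr),$$ belongs to $L^1(\Xi)$, with $$\|A*B\|_{L^1(\Xi)}\le\|A\|_{\mathcal T^1}\|B\|_{\mathcal T^1}\qquad\text{and}\qquad \int_\Xi A*B(x)\,\mathrm dx=\operatorname{tr}(A)\operatorname{tr}(B).$$ -/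

import Mathlib

open MeasureTheory
open scoped ENNReal InnerProductSpace

noncomputable section

/-- A separately continuous (normalized) Heisenberg multiplier on the locally compact abelian
group `Ξ`: a circle-valued 2-cocycle, normalized at `0`, for which
`x ↦ σ(x, ·)`, `σ(x, y) = m(x, y) / m(y, x)`, is a topological isomorphism of `Ξ` onto its
Pontryagin dual. Mathlib's Pontryagin dual is that of a multiplicative group, whence
`Multiplicative Ξ`. -/
structure IsHeisenbergMultiplier {Ξ : Type*} [AddCommGroup Ξ] [TopologicalSpace Ξ]
    (m : Ξ → Ξ → Circle) : Prop where
  cocycle : ∀ x y z, m (x + y) z * m x y = m x (y + z) * m y z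
  map_zero_right : ∀ x, m x 0 = 1
  map_zero_left : ∀ x, m 0 x = 1
  continuous_left : ∀ y, Continuous fun x => m x y
  continuous_right : ∀ x, Continuous fun y => m x y
  self_dual : ∃ e : Multiplicative Ξ ≃ₜ* PontryaginDual (Multiplicative Ξ),
    ∀ x y : Ξ, e (Multiplicative.ofAdd x) (Multiplicative.ofAdd y) = m x y / m y x

section Representation

variable {Ξ : Type*} [AddCommGroup Ξ] [MeasurableSpace Ξ]
  {H : Type*} [NormedAddCommGroup H] [InnerProductSpace ℂ H] [CompleteSpace H]

/-- `U` is a projective unitary representation of `Ξ` on `H` with multiplier `m`: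
`U_x U_y = m(x, y) U_{x + y}`, with measurable coefficient functions. -/
structure IsProjectiveRep (m : Ξ → Ξ → Circle) (U : Ξ → unitary (H →L[ℂ] H)) : Prop where
  mul_eq : ∀ x y, (U x : H →L[ℂ] H) * (U y : H →L[ℂ] H)
    = (m x y : ℂ) • (U (x + y) : H →L[ℂ] H)
  measurable_coeff : ∀ φ ψ : H, Measurable fun x => ⟪ψ, (U x : H →L[ℂ] H) φ⟫_ℂ

/-- Irreducibility: `H ≠ 0` and the only closed invariant subspaces are `0` and `H`. -/
def IsIrreducibleRep (U : Ξ → unitary (H →L[ℂ] H)) : Prop :=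
  Nontrivial H ∧ ∀ K : Submodule ℂ H, IsClosed (K : Set H) →
    (∀ x, ∀ v ∈ K, (U x : H →L[ℂ] H) v ∈ K) → K = ⊥ ∨ K = ⊤

/-- Square integrability: some coefficient function of two nonzero vectors is in `L²`. -/
def IsSquareIntegrableRep (U : Ξ → unitary (H →L[ℂ] H)) (μ : Measure Ξ) : Prop :=
  ∃ φ ψ : H, φ ≠ 0 ∧ ψ ≠ 0 ∧ MemLp (fun x => ⟪ψ, (U x : H →L[ℂ] H) φ⟫_ℂ) 2 μ

/-- The normalization of the Haar measure `μ` by the representation. For an irreducible square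
integrable representation there is one constant `c > 0` (depending on the scaling of `μ`) such
that `∫ |⟨U_x φ, ψ⟩|² dμ = c ‖φ‖² ‖ψ‖²` for all `φ, ψ`. Since the constant is the same for all
vectors, `c = 1` is fixed by one pair of nonzero vectors. -/
def IsNormalizedFor (μ : Measure Ξ) (U : Ξ → unitary (H →L[ℂ] H)) : Prop :=
  ∃ φ ψ : H, φ ≠ 0 ∧ ψ ≠ 0 ∧
    ∫⁻ x, ‖⟪ψ, (U x : H →L[ℂ] H) φ⟫_ℂ‖ₑ ^ 2 ∂μ = ‖φ‖ₑ ^ 2 * ‖ψ‖ₑ ^ 2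

end Representation

section Trace

variable {H : Type*} [NormedAddCommGroup H] [InnerProductSpace ℂ H] [CompleteSpace H]
  {ι : Type*}

/-- The trace norm `tr |A| = ∑ᵢ ⟨|A| bᵢ, bᵢ⟩ ∈ [0, ∞]`, `|A| = (A* A)^{1/2}`, evaluated in the
orthonormal basis `b` (on which its value does not depend). -/
def traceNorm (b : HilbertBasis ι ℂ H) (A : H →L[ℂ] H) : ℝ≥0∞ :=
  ∑' i, ENNReal.ofReal (⟪b i, CFC.abs A (b i)⟫_ℂ).re

/-- `A` is of trace class: `tr |A| < ∞`. -/
def IsTraceClass (b : HilbertBasis ι ℂ H) (A : H →L[ℂ] H) : Prop :=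
  traceNorm b A < ∞

/-- The trace `tr A = ∑ᵢ ⟨A bᵢ, bᵢ⟩`; for trace class `A` the sum converges absolutely and does
not depend on the orthonormal basis `b`. -/
def opTrace (b : HilbertBasis ι ℂ H) (A : H →L[ℂ] H) : ℂ :=
  ∑' i, ⟪b i, A (b i)⟫_ℂ

end Trace

section Convolution

variable {Ξ : Type*} {H : Type*} [NormedAddCommGroup H] [InnerProductSpace ℂ H] [CompleteSpace H]
  {ι : Type*}

/-- The shift `α_x(A) = U_x A U_x*`. -/
def opShift (U : Ξ → unitary (H →L[ℂ] H)) (x : Ξ) (A : H →L[ℂ] H) : H →L[ℂ] H :=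
  (U x : H →L[ℂ] H) * A * star (U x : H →L[ℂ] H)

/-- The reflection `β_-(A) = R A R*`. -/
def opReflect (R : unitary (H →L[ℂ] H)) (A : H →L[ℂ] H) : H →L[ℂ] H :=
  (R : H →L[ℂ] H) * A * star (R : H →L[ℂ] H)

/-- The convolution of two operators, `(A ∗ B)(x) = tr (A α_x(β_-(B)))`. -/
def opConv (b : HilbertBasis ι ℂ H) (U : Ξ → unitary (H →L[ℂ] H)) (R : unitary (H →L[ℂ] H))
    (A B : H →L[ℂ] H) (x : Ξ) : ℂ :=
  opTrace b (A * opShift U x (opReflect R B))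

end Convolution

end

/-! A trace class operator is an absolutely convergent sum of rank one operators: `A = ∑ |uᵢ⟩⟨vᵢ|`
and `B = ∑ |pₖ⟩⟨qₖ|`, where `∑ ‖uᵢ‖ ‖vᵢ‖` and `∑ ‖pₖ‖ ‖qₖ‖` are at most the trace norms
(`IsTraceClass.exists_isNuclearSum`). For one pair of rank one operators, `A ∗ B` is the product of
the coefficient `⟨vᵢ, U_x R pₖ⟩` with the conjugate of `⟨uᵢ, U_x R qₖ⟩`. Cauchy–Schwarz and
Godement's orthogonality relations (`IsProjectiveRep.integral_inner`) bound its `L¹` norm by `‖uᵢ‖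
‖vᵢ‖ ‖pₖ‖ ‖qₖ‖` and give it the integral `⟨vᵢ, uᵢ⟩ ⟨qₖ, pₖ⟩`, as `R` is unitary. Summation over `i`
and `k` proves both claims.

The orthogonality relations are derived from the normalization at a single pair of vectors. For
fixed `ψ` the map `φ ↦ ⟨ψ, U_x φ⟩` is a closed operator into `L²`. Its graph is a Hilbert space on
which translations act compatibly with `U`, so Schur's lemma makes the projection of the graph to
`H` a multiple of a unitary. Hence the operator is everywhere defined and isometric up to a factor
depending on `ψ`. The substitution `x ↦ -x` exchanges `φ` and `ψ` and identifies this factor as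
`‖ψ‖²`; polarization does the rest. -/

/-! ### Schur's lemma -/

section Schur

variable {Ξ : Type*} {H : Type*} [NormedAddCommGroup H] [InnerProductSpace ℂ H] [CompleteSpace H]

/-- The kernel of `S` is a closed invariant subspace. -/
theorem IsIrreducibleRep.eq_zero_or_injective_of_commute {U : Ξ → unitary (H →L[ℂ] H)}
    (hirr : IsIrreducibleRep U) {S : H →L[ℂ] H} (hS : ∀ x, Commute S (U x : H →L[ℂ] H)) :
    S = 0 ∨ ∀ v, S v = 0 → v = 0 := by
  rcases hirr.2 S.ker S.isClosed_ker (fun x v hv => by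
    have h := DFunLike.congr_fun (hS x) v
    change S v = 0 at hv
    change S ((U x : H →L[ℂ] H) v) = (U x : H →L[ℂ] H) (S v) at h
    change S ((U x : H →L[ℂ] H) v) = 0
    rw [h, hv, map_zero]) with h | h
  · right
    intro v hv
    have : v ∈ S.ker := hv
    rwa [h, Submodule.mem_bot] at this
  · left
    ext v
    have : v ∈ S.ker := h ▸ Submodule.mem_top
    exact this

/-- Schur's lemma for self-adjoint operators. -/
theorem IsIrreducibleRep.exists_eq_smul_one {U : Ξ → unitary (H →L[ℂ] H)}
    (hirr : IsIrreducibleRep U) {T : H →L[ℂ] H} (hT : IsSelfAdjoint T)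
    (hTU : ∀ x, Commute T (U x : H →L[ℂ] H)) : ∃ c : ℝ, T = c • (1 : H →L[ℂ] H) := by
  have := hirr.1
  obtain ⟨a, ha⟩ := ContinuousFunctionalCalculus.spectrum_nonempty (R := ℝ) T hT
  refine ⟨a, ?_⟩
  have hspec : ∀ c ∈ spectrum ℝ T, c = a := by
    intro c hc
    by_contra hne
    have hr : 0 < |c - a| / 2 := by
      have := abs_pos.2 (sub_ne_zero.2 hne)
      positivity
    -- A tent of half-width `|c - a| / 2` about `d`: the tents about two distinct spectral points
    -- `a` and `c` have product zero, yet neither of the resulting operators vanishes. This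
    -- contradicts the kernel dichotomy.
    let f : ℝ → ℝ → ℝ := fun d t => max 0 (|c - a| / 2 - |t - d|)
    have hf : ∀ d, Continuous (f d) := fun d => by fun_prop
    have hne0 : ∀ d ∈ spectrum ℝ T, cfc (f d) T ≠ 0 := by
      intro d hd h0
      rw [← cfc_zero ℝ T] at h0
      have := (cfc_eq_cfc_iff_eqOn hT (hf d).continuousOn continuousOn_const).1 h0 hd
      simp only [f, sub_self, abs_zero, sub_zero] at this
      rw [max_eq_right hr.le] at this
      exact hr.ne' this
    have hmul : cfc (f a) T * cfc (f c) T = 0 := by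
      rw [← cfc_mul (f a) (f c) T (hf a).continuousOn (hf c).continuousOn, ← cfc_zero ℝ T]
      congr 1
      ext t
      simp only [f, Pi.zero_apply]
      have h3 : |c - a| ≤ |t - a| + |t - c| := by
        have := abs_sub (t - a) (t - c)
        rwa [show t - a - (t - c) = c - a by ring] at this
      rcases le_total (|c - a| / 2) |t - a| with h | h
      · rw [max_eq_left (sub_nonpos.2 h), zero_mul]
      · rw [max_eq_left (a := 0) (b := |c - a| / 2 - |t - c|) (by linarith), mul_zero]
    rcases hirr.eq_zero_or_injective_of_commute (S := cfc (f a) T)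
      (fun x => (hTU x).cfc_real _) with h | h
    · exact hne0 a ha h
    · refine hne0 c hc ?_
      ext v
      exact h _ (DFunLike.congr_fun hmul v)
  calc T = cfc (fun x : ℝ => x) T := (cfc_id' ℝ T).symm
    _ = cfc (fun _ : ℝ => a) T := cfc_congr fun t ht => hspec t ht
    _ = a • 1 := by rw [cfc_const a T, Algebra.algebraMap_eq_smul_one]

end Schur

/-! ### Factorization of operators -/

section Douglas

variable {E F G : Type*} [NormedAddCommGroup E] [InnerProductSpace ℂ E]
  [NormedAddCommGroup F] [InnerProductSpace ℂ F] [CompleteSpace F]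
  [NormedAddCommGroup G] [InnerProductSpace ℂ G] [CompleteSpace G]

/-- Douglas' factorization: an operator dominated pointwise by `S` factors through `S` by a
contraction. -/
theorem ContinuousLinearMap.exists_eq_comp_of_norm_apply_le (A : E →L[ℂ] G) (S : E →L[ℂ] F)
    (h : ∀ x, ‖A x‖ ≤ ‖S x‖) : ∃ V : F →L[ℂ] G, ‖V‖ ≤ 1 ∧ ∀ x, V (S x) = A x := by
  let K : Submodule ℂ F := S.range.topologicalClosure
  have hK : IsClosed (K : Set F) := Submodule.isClosed_topologicalClosure _
  have : CompleteSpace K := hK.completeSpace_coe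
  let e : E →ₗ[ℂ] K := S.toLinearMap.codRestrict K
    fun x => Submodule.le_topologicalClosure _ (LinearMap.mem_range_self _ x)
  have he : DenseRange e := by
    intro y
    rw [closure_subtype]
    have : (Subtype.val '' Set.range e) = (S.range : Set F) := by
      rw [← Set.range_comp]
      rfl
    rw [this, ← Submodule.topologicalClosure_coe]
    exact y.2
  have hn : ∀ x, ‖A.toLinearMap x‖ ≤ 1 * ‖e x‖ := fun x => by
    rw [one_mul]; exact h x
  -- `S x ↦ A x` extends by continuity to the closure of the range of `S`; `V` is zero on the
  -- orthogonal complement.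
  refine ⟨(A.toLinearMap.extendOfNorm e).comp K.orthogonalProjectionOnto, ?_, fun x => ?_⟩
  · refine ContinuousLinearMap.opNorm_le_bound _ zero_le_one fun y => ?_
    refine (LinearMap.norm_extendOfNorm_apply_le he 1 hn _).trans ?_
    exact mul_le_mul_of_nonneg_left (K.norm_orthogonalProjectionOnto_apply_le y) zero_le_one
  · have : K.orthogonalProjectionOnto (S x) = e x :=
      Submodule.orthogonalProjectionOnto_mem_subspace_eq_self (e x)
    rw [ContinuousLinearMap.comp_apply, this, LinearMap.extendOfNorm_eq he ⟨1, hn⟩]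
    rfl

end Douglas

/-! ### Trace class operators as sums of rank one operators -/

section Nuclear

variable {H : Type*} [NormedAddCommGroup H] [InnerProductSpace ℂ H] {ι κ : Type*}

/-- Cauchy–Schwarz on finite sums, then Bessel's inequality for each factor. -/
theorem HilbertBasis.tsum_enorm_inner_mul_enorm_inner_le (b : HilbertBasis ι ℂ H) (x y : H) :
    ∑' i, ‖⟪x, b i⟫_ℂ‖ₑ * ‖⟪b i, y⟫_ℂ‖ₑ ≤ ‖x‖ₑ * ‖y‖ₑ := by
  rw [ENNReal.tsum_eq_iSup_sum]
  refine iSup_le fun s => ?_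
  have h : ∑ i ∈ s, ‖⟪x, b i⟫_ℂ‖ * ‖⟪b i, y⟫_ℂ‖ ≤ ‖x‖ * ‖y‖ := by
    refine le_of_sq_le_sq ?_ (by positivity)
    refine (Finset.sum_mul_sq_le_sq_mul_sq _ _ _).trans ?_
    rw [mul_pow]
    refine mul_le_mul ?_ (b.orthonormal.sum_inner_products_le y) (by positivity) (by positivity)
    simp_rw [norm_inner_symm x]
    exact b.orthonormal.sum_inner_products_le x
  simp_rw [← ofReal_norm, ← ENNReal.ofReal_mul (norm_nonneg _)]
  rw [← ENNReal.ofReal_sum_of_nonneg fun i _ => by positivity]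
  exact ENNReal.ofReal_le_ofReal h

/-- The family of rank one operators `|uᵢ⟩⟨vᵢ|` sums to the operator `A` strongly, with
`∑ᵢ ‖uᵢ‖ ‖vᵢ‖ < ∞`. -/
structure IsNuclearSum (u v : κ → H) (A : H →L[ℂ] H) : Prop where
  hasSum : ∀ x, HasSum (fun i => ⟪v i, x⟫_ℂ • u i) (A x)
  tsum_lt_top : ∑' i, ‖u i‖ₑ * ‖v i‖ₑ < ∞

theorem IsNuclearSum.hasSum_inner {u v : κ → H} {A : H →L[ℂ] H} (h : IsNuclearSum u v A)
    (x y : H) : HasSum (fun i => ⟪v i, x⟫_ℂ * ⟪y, u i⟫_ℂ) ⟪y, A x⟫_ℂ := by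
  simpa only [innerSL_apply_apply, inner_smul_right] using (h.hasSum x).mapL (innerSL ℂ y)

/-- The double series `⟨vᵢ, bⱼ⟩ ⟨bⱼ, uᵢ⟩` converges absolutely. Summing over `j` first gives `⟨vᵢ,
uᵢ⟩` by Parseval; summing over `i` first gives the diagonal entries of `A`. -/
theorem IsNuclearSum.hasSum_opTrace {u v : κ → H} {A : H →L[ℂ] H} (h : IsNuclearSum u v A)
    (b : HilbertBasis ι ℂ H) : HasSum (fun i => ⟪v i, u i⟫_ℂ) (opTrace b A) := by
  have hs : Summable fun p : κ × ι => ⟪v p.1, b p.2⟫_ℂ * ⟪b p.2, u p.1⟫_ℂ := by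
    refine Summable.of_enorm (ne_of_lt ?_)
    rw [ENNReal.tsum_prod']
    simp_rw [enorm_mul]
    refine lt_of_le_of_lt (ENNReal.tsum_le_tsum fun i =>
      b.tsum_enorm_inner_mul_enorm_inner_le (v i) (u i)) ?_
    simp_rw [mul_comm ‖v _‖ₑ]
    exact h.tsum_lt_top
  have h1 : HasSum (fun i => ⟪v i, u i⟫_ℂ) (∑' p : κ × ι, ⟪v p.1, b p.2⟫_ℂ * ⟪b p.2, u p.1⟫_ℂ) :=
    hs.hasSum.prod_fiberwise fun i => b.hasSum_inner_mul_inner (v i) (u i)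
  have h2 : HasSum (fun j => ⟪b j, A (b j)⟫_ℂ)
      (∑' p : κ × ι, ⟪v p.1, b p.2⟫_ℂ * ⟪b p.2, u p.1⟫_ℂ) := by
    refine ((Equiv.prodComm ι κ).hasSum_iff.2 hs.hasSum).prod_fiberwise fun j => ?_
    exact h.hasSum_inner (b j) (b j)
  rwa [opTrace, h2.tsum_eq]

theorem IsNuclearSum.mul_left {u v : κ → H} {A : H →L[ℂ] H} (h : IsNuclearSum u v A)
    (S : H →L[ℂ] H) : IsNuclearSum (fun i => S (u i)) v (S * A) where
  hasSum x := by
    change HasSum _ (S (A x))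
    simpa only [map_smul] using (h.hasSum x).mapL S
  tsum_lt_top := by
    have hS := ENNReal.mul_lt_top (a := ‖S‖ₑ) enorm_lt_top h.tsum_lt_top
    rw [← ENNReal.tsum_mul_left] at hS
    refine lt_of_le_of_lt (ENNReal.tsum_le_tsum fun i => ?_) hS
    rw [← mul_assoc]
    gcongr
    exact S.le_opENorm _

theorem IsNuclearSum.summable_norm_inner {u v : κ → H} {A : H →L[ℂ] H} (h : IsNuclearSum u v A) :
    Summable fun i => ‖⟪v i, u i⟫_ℂ‖ := by
  refine tsum_enorm_ne_top_iff_summable_norm.1 (ne_of_lt ?_)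
  refine lt_of_le_of_lt (ENNReal.tsum_le_tsum fun i => ?_) h.tsum_lt_top
  rw [mul_comm, ← ofReal_norm, ← ofReal_norm, ← ofReal_norm, ← ENNReal.ofReal_mul (norm_nonneg _)]
  exact ENNReal.ofReal_le_ofReal (norm_inner_le_norm _ _)

variable [CompleteSpace H]

theorem IsNuclearSum.mul_right {u v : κ → H} {A : H →L[ℂ] H} (h : IsNuclearSum u v A)
    (S : H →L[ℂ] H) : IsNuclearSum u (fun i => star S (v i)) (A * S) where
  hasSum x := by
    change HasSum _ (A (S x))
    simpa only [ContinuousLinearMap.star_eq_adjoint, ContinuousLinearMap.adjoint_inner_left]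
      using h.hasSum (S x)
  tsum_lt_top := by
    have hS := ENNReal.mul_lt_top (a := ‖star S‖ₑ) enorm_lt_top h.tsum_lt_top
    rw [← ENNReal.tsum_mul_left] at hS
    refine lt_of_le_of_lt (ENNReal.tsum_le_tsum fun i => ?_) hS
    rw [mul_left_comm]
    gcongr
    exact (star S).le_opENorm _

theorem IsSelfAdjoint.inner_apply_left {Q : H →L[ℂ] H} (hQ : IsSelfAdjoint Q) (x y : H) :
    ⟪Q x, y⟫_ℂ = ⟪x, Q y⟫_ℂ := by
  rw [← ContinuousLinearMap.adjoint_inner_right, ← ContinuousLinearMap.star_eq_adjoint, hQ.star_eq]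

theorem ContinuousLinearMap.norm_abs_apply (A : H →L[ℂ] H) (x : H) : ‖CFC.abs A x‖ = ‖A x‖ := by
  have h : ⟪CFC.abs A x, CFC.abs A x⟫_ℂ = ⟪A x, A x⟫_ℂ := by
    rw [(CFC.abs_nonneg A).isSelfAdjoint.inner_apply_left,
      ← ContinuousLinearMap.adjoint_inner_right A, ← ContinuousLinearMap.star_eq_adjoint]
    exact congrArg (fun S : H →L[ℂ] H => ⟪x, S x⟫_ℂ) (CFC.abs_mul_abs A)
  rw [@norm_eq_sqrt_re_inner ℂ, @norm_eq_sqrt_re_inner ℂ, h]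

/-- Since `‖|A| x‖ = ‖A x‖`, Douglas' factorization gives `|A| = V A`, so `|A|` is a sum of rank one
operators as well, and its diagonal is absolutely summable. -/
theorem IsNuclearSum.isTraceClass {u v : κ → H} {A : H →L[ℂ] H} (h : IsNuclearSum u v A)
    (b : HilbertBasis ι ℂ H) : IsTraceClass b A := by
  obtain ⟨V, -, hV⟩ := ContinuousLinearMap.exists_eq_comp_of_norm_apply_le (CFC.abs A) A
    fun x => (A.norm_abs_apply x).le
  have hVA : V * A = CFC.abs A := ContinuousLinearMap.ext hV
  have hn := h.mul_left V
  rw [hVA] at hn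
  refine lt_of_le_of_lt ?_ hn.tsum_lt_top
  calc traceNorm b A ≤ ∑' j, ‖⟪b j, CFC.abs A (b j)⟫_ℂ‖ₑ := by
        refine ENNReal.tsum_le_tsum fun j => ?_
        rw [← ofReal_norm]
        exact ENNReal.ofReal_le_ofReal (Complex.re_le_norm _)
    _ ≤ ∑' j, ∑' i, ‖⟪v i, b j⟫_ℂ‖ₑ * ‖⟪b j, V (u i)⟫_ℂ‖ₑ := by
        refine ENNReal.tsum_le_tsum fun j => ?_
        have h1 : HasSum (fun i => ⟪v i, b j⟫_ℂ * ⟪b j, V (u i)⟫_ℂ) ⟪b j, CFC.abs A (b j)⟫_ℂ := by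
          exact hn.hasSum_inner (b j) (b j)
        rw [← h1.tsum_eq]
        simp_rw [← enorm_mul]
        exact enorm_tsum_le_tsum_enorm
    _ = ∑' i, ∑' j, ‖⟪v i, b j⟫_ℂ‖ₑ * ‖⟪b j, V (u i)⟫_ℂ‖ₑ := ENNReal.tsum_comm
    _ ≤ ∑' i, ‖V (u i)‖ₑ * ‖v i‖ₑ := by
        refine ENNReal.tsum_le_tsum fun i => ?_
        rw [mul_comm ‖V (u i)‖ₑ]
        exact b.tsum_enorm_inner_mul_enorm_inner_le _ _

/-- With `Q = |A|^{1/2}` and `A = V |A|`, expanding `Q x` in the basis gives `A x = ∑ ⟨Q bᵢ, x⟩ V Q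
bᵢ`, while `∑ ‖Q bᵢ‖² = tr |A|`. -/
theorem IsTraceClass.exists_isNuclearSum {b : HilbertBasis ι ℂ H} {A : H →L[ℂ] H}
    (hA : IsTraceClass b A) : ∃ s : Set ι, s.Countable ∧ ∃ u v : s → H, IsNuclearSum u v A ∧
      ∑' i, ‖u i‖ₑ * ‖v i‖ₑ ≤ traceNorm b A := by
  let Q : H →L[ℂ] H := CFC.sqrt (CFC.abs A)
  have hQ : ∀ x, Q (Q x) = CFC.abs A x := fun x =>
    DFunLike.congr_fun (CFC.sqrt_mul_sqrt_self _ (CFC.abs_nonneg A)) x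
  have hQs : IsSelfAdjoint Q := (CFC.sqrt_nonneg (CFC.abs A)).isSelfAdjoint
  obtain ⟨V, hV1, hV⟩ := ContinuousLinearMap.exists_eq_comp_of_norm_apply_le A (CFC.abs A)
    fun x => (A.norm_abs_apply x).ge
  have hT : ∑' i, ‖Q (b i)‖ₑ * ‖Q (b i)‖ₑ = traceNorm b A := by
    refine tsum_congr fun i => ?_
    rw [← ofReal_norm, ← ENNReal.ofReal_mul (norm_nonneg _), ← hQ, ← hQs.inner_apply_left, ← sq]
    exact congrArg ENNReal.ofReal (inner_self_eq_norm_sq (𝕜 := ℂ) (Q (b i))).symm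
  -- The basis may be uncountable; discarding the zero terms leaves a countable index set, as the
  -- later exchange of sum and integral needs.
  let s : Set ι := {i | Q (b i) ≠ 0}
  have hs : s.Countable := by
    refine (Summable.countable_support_ennreal (hT.trans_lt hA).ne).mono fun i hi => ?_
    have : ‖Q (b i)‖ₑ ≠ 0 := enorm_ne_zero.2 hi
    exact mul_ne_zero this this
  have hle : ∑' i : s, ‖V (Q (b i))‖ₑ * ‖Q (b i)‖ₑ ≤ traceNorm b A := by
    refine le_trans (ENNReal.tsum_comp_le_tsum_of_injective Subtype.val_injective
      fun i => ‖V (Q (b i))‖ₑ * ‖Q (b i)‖ₑ) ?_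
    rw [← hT]
    refine ENNReal.tsum_le_tsum fun i => ?_
    gcongr
    rw [← ofReal_norm, ← ofReal_norm]
    exact ENNReal.ofReal_le_ofReal ((V.le_of_opNorm_le hV1 _).trans_eq (one_mul _))
  refine ⟨s, hs, fun i => V (Q (b i)), fun i => Q (b i), ⟨fun x => ?_, hle.trans_lt hA⟩, hle⟩
  have h1 : HasSum (fun i => ⟪Q (b i), x⟫_ℂ • V (Q (b i))) (A x) := by
    have := (b.hasSum_repr (Q x)).mapL (V ∘L Q)
    simpa only [ContinuousLinearMap.comp_apply, map_smul, b.repr_apply_apply, hQ, hV,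
      ← hQs.inner_apply_left] using this
  refine (hasSum_subtype_iff_of_support_subset (s := s)
    (f := fun i => ⟪Q (b i), x⟫_ℂ • V (Q (b i))) fun i hi h => hi ?_).2 h1
  simp [h]

end Nuclear

/-! ### Coefficient functions and the closed operator they define -/

section Coefficients

open Filter Topology

variable {Ξ : Type*} {H : Type*} [NormedAddCommGroup H] [InnerProductSpace ℂ H] [CompleteSpace H]

/-- The coefficient function `x ↦ ⟨U_x φ, ψ⟩`. -/
noncomputable def repCoeff (U : Ξ → unitary (H →L[ℂ] H)) (ψ φ : H) (x : Ξ) : ℂ :=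
  ⟪ψ, (U x : H →L[ℂ] H) φ⟫_ℂ

theorem repCoeff_add (U : Ξ → unitary (H →L[ℂ] H)) (ψ φ φ' : H) (x : Ξ) :
    repCoeff U ψ (φ + φ') x = repCoeff U ψ φ x + repCoeff U ψ φ' x := by
  simp [repCoeff]

theorem repCoeff_smul (U : Ξ → unitary (H →L[ℂ] H)) (ψ φ : H) (c : ℂ) (x : Ξ) :
    repCoeff U ψ (c • φ) x = c * repCoeff U ψ φ x := by
  simp [repCoeff]

theorem continuous_repCoeff (U : Ξ → unitary (H →L[ℂ] H)) (ψ : H) (x : Ξ) :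
    Continuous fun φ => repCoeff U ψ φ x := by
  unfold repCoeff
  fun_prop

theorem unitary_inner_map_map (V : unitary (H →L[ℂ] H)) (φ ψ : H) :
    ⟪(V : H →L[ℂ] H) φ, (V : H →L[ℂ] H) ψ⟫_ℂ = ⟪φ, ψ⟫_ℂ := by
  rw [← ContinuousLinearMap.adjoint_inner_right, ← ContinuousLinearMap.star_eq_adjoint]
  exact congrArg (fun S : H →L[ℂ] H => ⟪φ, S ψ⟫_ℂ) (Unitary.coe_star_mul_self V)

theorem unitary_apply_star_apply (V : unitary (H →L[ℂ] H)) (φ : H) :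
    (V : H →L[ℂ] H) (star (V : H →L[ℂ] H) φ) = φ :=
  DFunLike.congr_fun (Unitary.coe_mul_star_self V) φ

theorem unitary_star_apply_apply (V : unitary (H →L[ℂ] H)) (φ : H) :
    star (V : H →L[ℂ] H) ((V : H →L[ℂ] H) φ) = φ :=
  DFunLike.congr_fun (Unitary.coe_star_mul_self V) φ

/-- An injective bounded operator `j` into the space of an irreducible representation whose
domain carries compatible isometric bijections is a multiple of an isometry. -/
theorem IsIrreducibleRep.exists_comp_adjoint_eq_smul {U : Ξ → unitary (H →L[ℂ] H)}
    (hirr : IsIrreducibleRep U) {G : Type*} [NormedAddCommGroup G] [InnerProductSpace ℂ G]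
    [CompleteSpace G] (j : G →L[ℂ] H) (hj : Function.Injective j)
    (hinner : ∀ (y : Ξ) (g g' k k' : G), j k = (U y : H →L[ℂ] H) (j g) →
      j k' = (U y : H →L[ℂ] H) (j g') → ⟪k, k'⟫_ℂ = ⟪g, g'⟫_ℂ)
    (hforward : ∀ (y : Ξ) (g : G), ∃ k : G, j k = (U y : H →L[ℂ] H) (j g))
    (hbackward : ∀ (y : Ξ) (k : G), ∃ g : G, j k = (U y : H →L[ℂ] H) (j g)) :
    ∃ c : ℝ, (∀ h, j (j.adjoint h) = (c : ℂ) • h) ∧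
      ∀ g g', ⟪j g, j g'⟫_ℂ = (c : ℂ) * ⟪g, g'⟫_ℂ := by
  let T : H →L[ℂ] H := j ∘L j.adjoint
  have hT : IsSelfAdjoint T := by
    rw [ContinuousLinearMap.isSelfAdjoint_iff', ContinuousLinearMap.adjoint_comp,
      ContinuousLinearMap.adjoint_adjoint]
  have hTU : ∀ y, Commute T (U y : H →L[ℂ] H) := by
    intro y
    ext h
    change j (j.adjoint ((U y : H →L[ℂ] H) h)) = (U y : H →L[ℂ] H) (j (j.adjoint h))
    obtain ⟨k, hk⟩ := hforward y (j.adjoint h)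
    -- Every test vector `k'` is a translate of some `g'`, and translation preserves inner products,
    -- so `j.adjoint` intertwines as `j` does.
    have : j.adjoint ((U y : H →L[ℂ] H) h) = k := by
      refine ext_inner_left ℂ fun k' => ?_
      obtain ⟨g', hg'⟩ := hbackward y k'
      rw [ContinuousLinearMap.adjoint_inner_right, hg', unitary_inner_map_map,
        ← ContinuousLinearMap.adjoint_inner_right, hinner y _ _ _ _ hg' hk]
    rw [this, hk]
  obtain ⟨c, hc⟩ := hirr.exists_eq_smul_one hT hTU
  have hTc : ∀ h, j (j.adjoint h) = (c : ℂ) • h := fun h => by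
    have := DFunLike.congr_fun hc h
    rw [Complex.coe_smul]
    exact this
  refine ⟨c, hTc, fun g g' => ?_⟩
  -- Injectivity of `j` turns `j j* = c` into `j* j = c`.
  have hadj : j.adjoint (j g') = (c : ℂ) • g' := hj (by rw [hTc, map_smul])
  rw [← ContinuousLinearMap.adjoint_inner_right, hadj, inner_smul_right]

section Graph

variable [MeasurableSpace Ξ]

/-- The graph of the unbounded operator taking `φ` to its coefficient function against `ψ`, whose
domain consists of those `φ` with square integrable coefficient function. -/
noncomputable def coeffGraph (U : Ξ → unitary (H →L[ℂ] H)) (ψ : H) (μ : Measure Ξ) :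
    Submodule ℂ (WithLp 2 (H × Lp ℂ 2 μ)) where
  carrier := {p | (p.snd : Ξ → ℂ) =ᵐ[μ] repCoeff U ψ p.fst}
  zero_mem' := by
    change ((0 : Lp ℂ 2 μ) : Ξ → ℂ) =ᵐ[μ] repCoeff U ψ 0
    filter_upwards [Lp.coeFn_zero ℂ 2 μ] with x hx
    exact hx.trans (show (0 : ℂ) = _ by simp [repCoeff])
  add_mem' {p p'} hp hp' := by
    change ((p.snd + p'.snd : Lp ℂ 2 μ) : Ξ → ℂ) =ᵐ[μ] repCoeff U ψ (p.fst + p'.fst)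
    filter_upwards [Lp.coeFn_add p.snd p'.snd, hp, hp'] with x hx h h'
    rw [hx, Pi.add_apply, h, h', repCoeff_add]
  smul_mem' c p hp := by
    change ((c • p.snd : Lp ℂ 2 μ) : Ξ → ℂ) =ᵐ[μ] repCoeff U ψ (c • p.fst)
    filter_upwards [Lp.coeFn_smul c p.snd, hp] with x hx h
    rw [hx, Pi.smul_apply, h, repCoeff_smul, smul_eq_mul]

/-- An `L²`-convergent sequence has an a.e. convergent subsequence, and at each `x` the coefficient
is continuous in `φ`; so the two limits agree a.e. -/
theorem isClosed_coeffGraph (U : Ξ → unitary (H →L[ℂ] H)) (ψ : H) (μ : Measure Ξ) :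
    IsClosed (coeffGraph U ψ μ : Set (WithLp 2 (H × Lp ℂ 2 μ))) := by
  refine IsSeqClosed.isClosed fun p p₀ hp hlim => ?_
  have h1 : Tendsto (fun n => (p n).fst) atTop (𝓝 p₀.fst) :=
    ((WithLp.fstL 2 ℂ H (Lp ℂ 2 μ)).continuous.tendsto p₀).comp hlim
  have h2 : Tendsto (fun n => (p n).snd) atTop (𝓝 p₀.snd) :=
    ((WithLp.sndL 2 ℂ H (Lp ℂ 2 μ)).continuous.tendsto p₀).comp hlim
  obtain ⟨ns, hns, hae⟩ := (tendstoInMeasure_of_tendsto_Lp h2).exists_seq_tendsto_ae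
  have hp' : ∀ᵐ x ∂μ, ∀ n, (p n).snd x = repCoeff U ψ (p n).fst x := ae_all_iff.2 hp
  change (p₀.snd : Ξ → ℂ) =ᵐ[μ] repCoeff U ψ p₀.fst
  filter_upwards [hae, hp'] with x hx hpx
  refine tendsto_nhds_unique hx ?_
  simp_rw [hpx]
  exact (((continuous_repCoeff U ψ x).tendsto _).comp h1).comp hns.tendsto_atTop

theorem inner_coeffGraph {U : Ξ → unitary (H →L[ℂ] H)} {ψ : H} {μ : Measure Ξ}
    (g g' : coeffGraph U ψ μ) : ⟪g, g'⟫_ℂ = ⟪g.1.fst, g'.1.fst⟫_ℂ +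
      ∫ x, ⟪repCoeff U ψ g.1.fst x, repCoeff U ψ g'.1.fst x⟫_ℂ ∂μ := by
  have h : ⟪g.1.snd, g'.1.snd⟫_ℂ =
      ∫ x, ⟪repCoeff U ψ g.1.fst x, repCoeff U ψ g'.1.fst x⟫_ℂ ∂μ := by
    rw [L2.inner_def]
    refine integral_congr_ae ?_
    filter_upwards [g.2, g'.2] with x hx hx'
    rw [hx, hx']
  rw [← h]
  rfl

theorem coeffGraph_ext {U : Ξ → unitary (H →L[ℂ] H)} {ψ : H} {μ : Measure Ξ}
    {g g' : coeffGraph U ψ μ} (h : g.1.fst = g'.1.fst) : g = g' := by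
  refine Subtype.ext (WithLp.ofLp_injective 2 (Prod.ext h (Lp.ext ?_)))
  filter_upwards [g.2, g'.2] with x hx hx'
  change g.1.snd x = g'.1.snd x
  rw [hx, hx', h]

theorem memLp_of_mem_coeffGraph {U : Ξ → unitary (H →L[ℂ] H)} {ψ : H} {μ : Measure Ξ}
    (g : coeffGraph U ψ μ) : MemLp (repCoeff U ψ g.1.fst) 2 μ :=
  (memLp_congr_ae g.2).1 (Lp.memLp _)

theorem exists_mem_coeffGraph {U : Ξ → unitary (H →L[ℂ] H)} {ψ φ : H} {μ : Measure Ξ}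
    (h : MemLp (repCoeff U ψ φ) 2 μ) : ∃ g : coeffGraph U ψ μ, g.1.fst = φ :=
  ⟨⟨WithLp.toLp 2 (φ, h.toLp _), h.coeFn_toLp⟩, rfl⟩

end Graph

variable [AddCommGroup Ξ] [MeasurableSpace Ξ] {m : Ξ → Ξ → Circle}
  {U : Ξ → unitary (H →L[ℂ] H)}

theorem IsProjectiveRep.measurable_repCoeff (hU : IsProjectiveRep m U) (ψ φ : H) :
    Measurable (repCoeff U ψ φ) := hU.measurable_coeff φ ψ

theorem IsProjectiveRep.apply_apply (hU : IsProjectiveRep m U) (x y : Ξ) (φ : H) :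
    (U x : H →L[ℂ] H) ((U y : H →L[ℂ] H) φ) = (m x y : ℂ) • (U (x + y) : H →L[ℂ] H) φ :=
  DFunLike.congr_fun (hU.mul_eq x y) φ

theorem IsProjectiveRep.apply_zero (hU : IsProjectiveRep m U) (φ : H) :
    (U 0 : H →L[ℂ] H) φ = (m 0 0 : ℂ) • φ := by
  have h := congrArg (fun w => star (U 0 : H →L[ℂ] H) w) (hU.apply_apply 0 0 φ)
  beta_reduce at h
  rwa [add_zero, map_smul, unitary_star_apply_apply, unitary_star_apply_apply] at h

theorem IsProjectiveRep.apply_neg (hU : IsProjectiveRep m U) (x : Ξ) (φ : H) :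
    (U (-x) : H →L[ℂ] H) φ = ((m x (-x) * m 0 0 : Circle) : ℂ) • star (U x : H →L[ℂ] H) φ := by
  have h := congrArg (fun w => star (U x : H →L[ℂ] H) w) (hU.apply_apply x (-x) φ)
  beta_reduce at h
  rwa [add_neg_cancel, hU.apply_zero, smul_smul, map_smul, unitary_star_apply_apply,
    ← Circle.coe_mul] at h

/-- `U_{-x}` is `U_x*` up to a phase. This is the symmetry that exchanges the two vectors. -/
theorem IsProjectiveRep.norm_repCoeff_neg (hU : IsProjectiveRep m U) (ψ φ : H) (x : Ξ) :
    ‖repCoeff U ψ φ (-x)‖ = ‖repCoeff U φ ψ x‖ := by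
  rw [repCoeff, hU.apply_neg, inner_smul_right, norm_mul, Circle.norm_coe, one_mul,
    ContinuousLinearMap.star_eq_adjoint, ContinuousLinearMap.adjoint_inner_right, repCoeff,
    norm_inner_symm]

theorem IsProjectiveRep.repCoeff_apply (hU : IsProjectiveRep m U) (ψ φ : H) (x y : Ξ) :
    repCoeff U ψ ((U y : H →L[ℂ] H) φ) x = (m x y : ℂ) * repCoeff U ψ φ (x + y) := by
  rw [repCoeff, hU.apply_apply, inner_smul_right, repCoeff]

theorem IsProjectiveRep.inner_repCoeff_apply (hU : IsProjectiveRep m U) (ψ φ φ' : H) (x y : Ξ) :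
    ⟪repCoeff U ψ ((U y : H →L[ℂ] H) φ) x, repCoeff U ψ ((U y : H →L[ℂ] H) φ') x⟫_ℂ =
      ⟪repCoeff U ψ φ (x + y), repCoeff U ψ φ' (x + y)⟫_ℂ := by
  have h : ((m x y : Circle) : ℂ) * (starRingEnd ℂ) (m x y : ℂ) = 1 := by
    rw [Complex.mul_conj, Circle.normSq_coe, Complex.ofReal_one]
  rw [hU.repCoeff_apply, hU.repCoeff_apply]
  simp only [RCLike.inner_apply, map_mul]
  linear_combination (repCoeff U ψ φ' (x + y) * (starRingEnd ℂ) (repCoeff U ψ φ (x + y))) * h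

variable [MeasurableAdd Ξ] {μ : Measure Ξ} [μ.IsAddRightInvariant]

/-- Applying `U_y` to `φ` translates the coefficient function by `y`, up to a phase. -/
theorem IsProjectiveRep.memLp_repCoeff_apply_iff (hU : IsProjectiveRep m U) (ψ φ : H) (y : Ξ) :
    MemLp (repCoeff U ψ ((U y : H →L[ℂ] H) φ)) 2 μ ↔ MemLp (repCoeff U ψ φ) 2 μ := by
  have h1 : ∀ x, ‖repCoeff U ψ ((U y : H →L[ℂ] H) φ) x‖ = ‖repCoeff U ψ φ (x + y)‖ := fun x => by
    rw [hU.repCoeff_apply, norm_mul, Circle.norm_coe, one_mul]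
  have h2 : MemLp (fun x => repCoeff U ψ φ (x + y)) 2 μ ↔ MemLp (repCoeff U ψ φ) 2 μ := by
    have h := memLp_map_measure_iff (μ := μ) (p := 2) (f := fun x => x + y) (g := repCoeff U ψ φ)
      (hU.measurable_repCoeff _ _).aestronglyMeasurable (measurable_add_const y).aemeasurable
    rw [map_add_right_eq_self] at h
    exact h.symm
  rw [← h2]
  exact memLp_congr_norm (hU.measurable_repCoeff _ _).aestronglyMeasurable
    ((hU.measurable_repCoeff _ _).comp (measurable_add_const y)).aestronglyMeasurable
    (Eventually.of_forall h1)

theorem IsProjectiveRep.integral_inner_repCoeff_apply (hU : IsProjectiveRep m U) (ψ φ φ' : H)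
    (y : Ξ) :
    ∫ x, ⟪repCoeff U ψ ((U y : H →L[ℂ] H) φ) x, repCoeff U ψ ((U y : H →L[ℂ] H) φ') x⟫_ℂ ∂μ =
      ∫ x, ⟪repCoeff U ψ φ x, repCoeff U ψ φ' x⟫_ℂ ∂μ := by
  simp_rw [hU.inner_repCoeff_apply]
  exact integral_add_right_eq_self (fun x => ⟪repCoeff U ψ φ x, repCoeff U ψ φ' x⟫_ℂ) y

/-- If some nonzero vector has a square integrable coefficient function against `ψ`, then all
vectors have, and up to a factor the coefficient map is isometric. -/
theorem IsProjectiveRep.exists_integral_inner (hU : IsProjectiveRep m U)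
    (hirr : IsIrreducibleRep U) {ψ φ₀ : H} (hφ₀ : φ₀ ≠ 0) (h₀ : MemLp (repCoeff U ψ φ₀) 2 μ) :
    ∃ c : ℂ, ∀ φ, MemLp (repCoeff U ψ φ) 2 μ ∧
      ∀ φ', ∫ x, ⟪repCoeff U ψ φ x, repCoeff U ψ φ' x⟫_ℂ ∂μ = c * ⟪φ, φ'⟫_ℂ := by
  let G := coeffGraph U ψ μ
  have : CompleteSpace G := (isClosed_coeffGraph U ψ μ).completeSpace_coe
  let j : G →L[ℂ] H := (WithLp.fstL 2 ℂ H (Lp ℂ 2 μ)).comp G.subtypeL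
  have hj : ∀ g : G, j g = g.1.fst := fun _ => rfl
  have hinner : ∀ (y : Ξ) (g g' k k' : G), j k = (U y : H →L[ℂ] H) (j g) →
      j k' = (U y : H →L[ℂ] H) (j g') → ⟪k, k'⟫_ℂ = ⟪g, g'⟫_ℂ := by
    intro y g g' k k' hk hk'
    rw [hj, hj] at hk hk'
    rw [inner_coeffGraph, inner_coeffGraph, hk, hk', unitary_inner_map_map,
      hU.integral_inner_repCoeff_apply]
  have hforward : ∀ (y : Ξ) (g : G), ∃ k : G, j k = (U y : H →L[ℂ] H) (j g) := fun y g =>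
    exists_mem_coeffGraph ((hU.memLp_repCoeff_apply_iff ψ _ y).2 (memLp_of_mem_coeffGraph g))
  have hbackward : ∀ (y : Ξ) (k : G), ∃ g : G, j k = (U y : H →L[ℂ] H) (j g) := by
    intro y k
    have hk := memLp_of_mem_coeffGraph k
    rw [← unitary_apply_star_apply (U y) k.1.fst, hU.memLp_repCoeff_apply_iff] at hk
    obtain ⟨g, hg⟩ := exists_mem_coeffGraph hk
    refine ⟨g, ?_⟩
    rw [hj g, hg, unitary_apply_star_apply, hj]
  have hinj : Function.Injective j := fun g g' h => coeffGraph_ext h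
  obtain ⟨c, hTc, hjj⟩ := hirr.exists_comp_adjoint_eq_smul j hinj hinner hforward hbackward
  obtain ⟨g₀, hg₀⟩ := exists_mem_coeffGraph h₀
  -- The given `φ₀` makes the graph nontrivial, so `c ≠ 0`; then `j j* = c` makes `j` surjective,
  -- that is, every `φ` lies in the domain.
  have hc0 : (c : ℂ) ≠ 0 := by
    intro h0
    have := hjj g₀ g₀
    rw [h0, zero_mul, hj, hg₀] at this
    exact hφ₀ (inner_self_eq_zero.1 this)
  have hex : ∀ φ, ∃ g : G, g.1.fst = φ := fun φ => ⟨(c⁻¹ : ℂ) • j.adjoint φ, by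
    rw [← hj, map_smul, hTc, smul_smul, inv_mul_cancel₀ hc0, one_smul]⟩
  -- The graph inner product is `⟨φ, φ'⟩` plus the integral and also equals `c⁻¹ ⟨φ, φ'⟩`.
  refine ⟨(c : ℂ)⁻¹ - 1, fun φ => ?_⟩
  obtain ⟨g, hg⟩ := hex φ
  refine ⟨hg ▸ memLp_of_mem_coeffGraph g, fun φ' => ?_⟩
  obtain ⟨g', hg'⟩ := hex φ'
  have h1 := hjj g g'
  rw [inner_coeffGraph, hj, hj, hg, hg'] at h1
  have h2 := (inv_mul_eq_iff_eq_mul₀ hc0).2 h1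
  linear_combination -h2

end Coefficients

/-! ### Godement's orthogonality relations -/

section Orthogonality

variable {Ξ : Type*} {H : Type*} [NormedAddCommGroup H] [InnerProductSpace ℂ H] [CompleteSpace H]
  [AddCommGroup Ξ] [MeasurableSpace Ξ] [MeasurableAdd Ξ] [MeasurableNeg Ξ] {m : Ξ → Ξ → Circle}
  {U : Ξ → unitary (H →L[ℂ] H)} {μ : Measure Ξ} [μ.IsAddRightInvariant] [μ.IsNegInvariant]

omit [MeasurableAdd Ξ] [μ.IsAddRightInvariant] in
theorem IsProjectiveRep.lintegral_repCoeff_swap (hU : IsProjectiveRep m U) (ψ φ : H) :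
    ∫⁻ x, ‖repCoeff U ψ φ x‖ₑ ^ 2 ∂μ = ∫⁻ x, ‖repCoeff U φ ψ x‖ₑ ^ 2 ∂μ := by
  rw [← lintegral_neg_eq_self]
  refine lintegral_congr fun x => ?_
  rw [← ofReal_norm, hU.norm_repCoeff_neg, ofReal_norm]

omit [MeasurableAdd Ξ] [MeasurableNeg Ξ] [μ.IsAddRightInvariant] [μ.IsNegInvariant] in
theorem IsProjectiveRep.memLp_two_repCoeff_iff (hU : IsProjectiveRep m U) (ψ φ : H) :
    MemLp (repCoeff U ψ φ) 2 μ ↔ ∫⁻ x, ‖repCoeff U ψ φ x‖ₑ ^ 2 ∂μ < ∞ := by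
  have h := eLpNorm_lt_top_iff_lintegral_rpow_enorm_lt_top (μ := μ) (f := repCoeff U ψ φ) two_ne_zero
    ENNReal.ofNat_ne_top
  simp only [ENNReal.toReal_ofNat, ENNReal.rpow_ofNat] at h
  rw [← h]
  exact ⟨fun h => h.2, fun h => ⟨(hU.measurable_repCoeff _ _).aestronglyMeasurable, h⟩⟩

/-- The square integrability of one nonzero coefficient entails that of all of them. -/
theorem IsProjectiveRep.exists_integral_inner_of_normalized (hU : IsProjectiveRep m U)
    (hirr : IsIrreducibleRep U) (hμ : IsNormalizedFor μ U) (ψ : H) :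
    ∃ c : ℂ, ∀ φ, MemLp (repCoeff U ψ φ) 2 μ ∧
      ∀ φ', ∫ x, ⟪repCoeff U ψ φ x, repCoeff U ψ φ' x⟫_ℂ ∂μ = c * ⟪φ, φ'⟫_ℂ := by
  obtain ⟨φ₀, ψ₀, hφ₀, hψ₀, h⟩ := hμ
  have h₀ : MemLp (repCoeff U ψ₀ φ₀) 2 μ := by
    rw [hU.memLp_two_repCoeff_iff]
    refine h.trans_lt ?_
    exact ENNReal.mul_lt_top (ENNReal.pow_lt_top enorm_lt_top) (ENNReal.pow_lt_top enorm_lt_top)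
  -- Against `ψ₀` every vector, in particular `ψ`, has a square integrable coefficient. Exchanging
  -- the two vectors makes `ψ₀` a nonzero vector that is square integrable against `ψ`.
  obtain ⟨c, hc⟩ := hU.exists_integral_inner hirr hφ₀ h₀
  refine hU.exists_integral_inner hirr hψ₀ ?_
  rw [hU.memLp_two_repCoeff_iff, hU.lintegral_repCoeff_swap, ← hU.memLp_two_repCoeff_iff]
  exact (hc ψ).1

omit [AddCommGroup Ξ] [MeasurableAdd Ξ] [MeasurableNeg Ξ] in
theorem integral_inner_self_eq_ofReal {f : Ξ → ℂ} (hf : Measurable f) {μ : Measure Ξ} :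
    ∫ x, ⟪f x, f x⟫_ℂ ∂μ = ((∫⁻ x, ‖f x‖ₑ ^ 2 ∂μ).toReal : ℂ) := by
  have h : ∫ x, ‖f x‖ ^ 2 ∂μ = (∫⁻ x, ‖f x‖ₑ ^ 2 ∂μ).toReal := by
    rw [integral_eq_lintegral_of_nonneg_ae (Filter.Eventually.of_forall fun x => by positivity)
      (hf.norm.pow_const 2).aestronglyMeasurable]
    congr 1
    refine lintegral_congr fun x => ?_
    rw [← ofReal_norm, ENNReal.ofReal_pow (norm_nonneg _)]
  rw [← h, ← integral_complex_ofReal]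
  refine integral_congr_ae (Filter.Eventually.of_forall fun x => ?_)
  simp [inner_self_eq_norm_sq_to_K]

/-- Godement's orthogonality relations on the diagonal of the second argument. -/
theorem IsProjectiveRep.integral_inner_same (hU : IsProjectiveRep m U)
    (hirr : IsIrreducibleRep U) (hμ : IsNormalizedFor μ U) (ψ φ φ' : H) :
    ∫ x, ⟪repCoeff U ψ φ x, repCoeff U ψ φ' x⟫_ℂ ∂μ = ⟪ψ, ψ⟫_ℂ * ⟪φ, φ'⟫_ℂ := by
  choose c hc using hU.exists_integral_inner_of_normalized hirr hμ
  obtain ⟨φ₀, ψ₀, hφ₀, hψ₀, h⟩ := hμ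
  -- This symmetry makes `c` proportional to the squared norm; the normalized pair fixes the ratio
  -- as one.
  have hsymm : ∀ ψ φ, c ψ * ⟪φ, φ⟫_ℂ = c φ * ⟪ψ, ψ⟫_ℂ := by
    intro ψ φ
    rw [← (hc ψ φ).2, ← (hc φ ψ).2, integral_inner_self_eq_ofReal (hU.measurable_repCoeff _ _),
      integral_inner_self_eq_ofReal (hU.measurable_repCoeff _ _), hU.lintegral_repCoeff_swap]
  have h1 : ⟪φ₀, φ₀⟫_ℂ ≠ 0 := inner_self_ne_zero.2 hφ₀
  have h2 : c ψ₀ = ⟪ψ₀, ψ₀⟫_ℂ := by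
    refine mul_right_cancel₀ h1 ?_
    rw [← (hc ψ₀ φ₀).2, integral_inner_self_eq_ofReal (hU.measurable_repCoeff _ _)]
    have h' : ∫⁻ x, ‖repCoeff U ψ₀ φ₀ x‖ₑ ^ 2 ∂μ = ‖φ₀‖ₑ ^ 2 * ‖ψ₀‖ₑ ^ 2 := h
    rw [h', inner_self_eq_norm_sq_to_K, inner_self_eq_norm_sq_to_K]
    simp [mul_comm]
  have h3 : c ψ = ⟪ψ, ψ⟫_ℂ := by
    have := hsymm ψ ψ₀
    rw [h2, mul_comm] at this
    exact mul_left_cancel₀ (inner_self_ne_zero.2 hψ₀) this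
  rw [(hc ψ φ).2, h3]

theorem IsProjectiveRep.memLp_repCoeff (hU : IsProjectiveRep m U)
    (hirr : IsIrreducibleRep U) (hμ : IsNormalizedFor μ U) (ψ φ : H) :
    MemLp (repCoeff U ψ φ) 2 μ :=
  ((hU.exists_integral_inner_of_normalized hirr hμ ψ).choose_spec φ).1

theorem IsProjectiveRep.lintegral_repCoeff (hU : IsProjectiveRep m U)
    (hirr : IsIrreducibleRep U) (hμ : IsNormalizedFor μ U) (ψ φ : H) :
    ∫⁻ x, ‖repCoeff U ψ φ x‖ₑ ^ 2 ∂μ = (‖ψ‖ₑ * ‖φ‖ₑ) ^ 2 := by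
  have h := hU.integral_inner_same hirr hμ ψ φ φ
  rw [integral_inner_self_eq_ofReal (hU.measurable_repCoeff _ _), inner_self_eq_norm_sq_to_K,
    inner_self_eq_norm_sq_to_K] at h
  have h' : (∫⁻ x, ‖repCoeff U ψ φ x‖ₑ ^ 2 ∂μ).toReal = (‖ψ‖ * ‖φ‖) ^ 2 := by
    rw [mul_pow]
    apply Complex.ofReal_injective
    rw [h]
    push_cast
    rfl
  rw [← ENNReal.ofReal_toReal ((hU.memLp_two_repCoeff_iff ψ φ).1 (hU.memLp_repCoeff hirr hμ ψ φ)).ne,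
    h', ENNReal.ofReal_pow (by positivity), ENNReal.ofReal_mul (norm_nonneg _), ofReal_norm,
    ofReal_norm]

theorem IsProjectiveRep.lintegral_mul_le (hU : IsProjectiveRep m U)
    (hirr : IsIrreducibleRep U) (hμ : IsNormalizedFor μ U) (ψ φ ψ' φ' : H) :
    ∫⁻ x, ‖repCoeff U ψ φ x‖ₑ * ‖repCoeff U ψ' φ' x‖ₑ ∂μ ≤
      (‖ψ‖ₑ * ‖φ‖ₑ) * (‖ψ'‖ₑ * ‖φ'‖ₑ) := by
  have h := ENNReal.lintegral_mul_le_Lp_mul_Lq μ Real.HolderConjugate.two_two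
    (hU.measurable_repCoeff ψ φ).enorm.aemeasurable
    (hU.measurable_repCoeff ψ' φ').enorm.aemeasurable
  simp only [ENNReal.rpow_ofNat, hU.lintegral_repCoeff hirr hμ] at h
  simp only [← ENNReal.rpow_natCast, ← ENNReal.rpow_mul] at h
  norm_num at h
  exact h

theorem IsProjectiveRep.integrable_inner (hU : IsProjectiveRep m U)
    (hirr : IsIrreducibleRep U) (hμ : IsNormalizedFor μ U) (ψ φ ψ' φ' : H) :
    Integrable (fun x => ⟪repCoeff U ψ φ x, repCoeff U ψ' φ' x⟫_ℂ) μ := by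
  refine ⟨((hU.measurable_repCoeff _ _).inner (hU.measurable_repCoeff _ _)).aestronglyMeasurable,
    lt_of_le_of_lt (lintegral_mono fun x => ?_) ((hU.lintegral_mul_le hirr hμ ψ φ ψ' φ').trans_lt ?_)⟩
  · change ‖⟪repCoeff U ψ φ x, repCoeff U ψ' φ' x⟫_ℂ‖ₑ ≤ _
    rw [RCLike.inner_apply', enorm_mul, RCLike.enorm_conj]
  · exact ENNReal.mul_lt_top (ENNReal.mul_lt_top enorm_lt_top enorm_lt_top)
      (ENNReal.mul_lt_top enorm_lt_top enorm_lt_top)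

/-- Godement's orthogonality relations. -/
theorem IsProjectiveRep.integral_inner (hU : IsProjectiveRep m U)
    (hirr : IsIrreducibleRep U) (hμ : IsNormalizedFor μ U) (ψ φ ψ' φ' : H) :
    ∫ x, ⟪repCoeff U ψ φ x, repCoeff U ψ' φ' x⟫_ℂ ∂μ = ⟪ψ', ψ⟫_ℂ * ⟪φ, φ'⟫_ℂ := by
  have hi := hU.integrable_inner hirr hμ
  have hadd : ∀ ψ ψ' : H, ∀ x, ⟪repCoeff U (ψ + ψ') φ x, repCoeff U (ψ + ψ') φ' x⟫_ℂ =
      (⟪repCoeff U ψ φ x, repCoeff U ψ φ' x⟫_ℂ + ⟪repCoeff U ψ' φ x, repCoeff U ψ' φ' x⟫_ℂ) +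
      (⟪repCoeff U ψ φ x, repCoeff U ψ' φ' x⟫_ℂ + ⟪repCoeff U ψ' φ x, repCoeff U ψ φ' x⟫_ℂ) := by
    intro ψ ψ' x
    simp only [repCoeff, inner_add_left, inner_add_right]
    ring
  -- Expanding the diagonal relation at `ψ + ψ'` gives the sum of the two mixed integrals. Replacing
  -- `ψ'` by `i ψ'` gives their difference.
  have key : ∀ ψ ψ' : H, ∫ x, ⟪repCoeff U ψ φ x, repCoeff U ψ' φ' x⟫_ℂ ∂μ +
      ∫ x, ⟪repCoeff U ψ' φ x, repCoeff U ψ φ' x⟫_ℂ ∂μ =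
      (⟪ψ', ψ⟫_ℂ + ⟪ψ, ψ'⟫_ℂ) * ⟪φ, φ'⟫_ℂ := by
    intro ψ ψ'
    have h := hU.integral_inner_same hirr hμ (ψ + ψ') φ φ'
    simp_rw [hadd] at h
    rw [integral_add ((hi _ _ _ _).fun_add (hi _ _ _ _)) ((hi _ _ _ _).fun_add (hi _ _ _ _)),
      integral_add (hi _ _ _ _) (hi _ _ _ _), integral_add (hi _ _ _ _) (hi _ _ _ _),
      hU.integral_inner_same hirr hμ, hU.integral_inner_same hirr hμ] at h
    simp only [inner_add_left, inner_add_right] at h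
    linear_combination h
  have h1 := key ψ ψ'
  have h2 := key ψ (Complex.I • ψ')
  have h3 : ∀ x, ⟪repCoeff U ψ φ x, repCoeff U (Complex.I • ψ') φ' x⟫_ℂ =
      -Complex.I * ⟪repCoeff U ψ φ x, repCoeff U ψ' φ' x⟫_ℂ := by
    intro x
    simp only [RCLike.inner_apply', repCoeff, inner_smul_left, Complex.conj_I]
    ring
  have h4 : ∀ x, ⟪repCoeff U (Complex.I • ψ') φ x, repCoeff U ψ φ' x⟫_ℂ =
      Complex.I * ⟪repCoeff U ψ' φ x, repCoeff U ψ φ' x⟫_ℂ := by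
    intro x
    simp only [RCLike.inner_apply', repCoeff, inner_smul_left, map_mul, Complex.conj_I, map_neg]
    ring
  simp_rw [h3, h4, integral_const_mul, inner_smul_left, inner_smul_right, Complex.conj_I] at h2
  generalize ∫ x, ⟪repCoeff U ψ φ x, repCoeff U ψ' φ' x⟫_ℂ ∂μ = F at *
  generalize ∫ x, ⟪repCoeff U ψ' φ x, repCoeff U ψ φ' x⟫_ℂ ∂μ = F' at *
  linear_combination (1 / 2 : ℂ) * h1 + (1 / 2 : ℂ) * Complex.I * h2
    + (1 / 2 : ℂ) * (F - F' - ⟪ψ', ψ⟫_ℂ * ⟪φ, φ'⟫_ℂ + ⟪ψ, ψ'⟫_ℂ * ⟪φ, φ'⟫_ℂ) * Complex.I_sq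

end Orthogonality

/-! ### Convolution of operators -/

section Convolution

variable {Ξ : Type*} {H : Type*} [NormedAddCommGroup H] [InnerProductSpace ℂ H] [CompleteSpace H]
  {κ κ' ι : Type*}

theorem IsNuclearSum.opShift_opReflect {p q : κ → H} {B : H →L[ℂ] H} (h : IsNuclearSum p q B)
    (U : Ξ → unitary (H →L[ℂ] H)) (R : unitary (H →L[ℂ] H)) (x : Ξ) :
    IsNuclearSum (fun k => (U x : H →L[ℂ] H) ((R : H →L[ℂ] H) (p k)))
      (fun k => (U x : H →L[ℂ] H) ((R : H →L[ℂ] H) (q k))) (opShift U x (opReflect R B)) := by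
  have h' := (((h.mul_left (R : H →L[ℂ] H)).mul_right (star (R : H →L[ℂ] H))).mul_left
    (U x : H →L[ℂ] H)).mul_right (star (U x : H →L[ℂ] H))
  simpa only [star_star, opShift, opReflect] using h'

theorem enorm_unitary_apply (V : unitary (H →L[ℂ] H)) (φ : H) :
    ‖(V : H →L[ℂ] H) φ‖ₑ = ‖φ‖ₑ := by
  rw [← ofReal_norm, ← ofReal_norm, @norm_eq_sqrt_re_inner ℂ, @norm_eq_sqrt_re_inner ℂ _ _ _ _ φ,
    unitary_inner_map_map]

/-- The summands of `A ∗ B` for `A = ∑ᵢ |uᵢ⟩⟨vᵢ|` and `B = ∑ₖ |pₖ⟩⟨qₖ|`. -/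
noncomputable def convTerm (U : Ξ → unitary (H →L[ℂ] H)) (R : unitary (H →L[ℂ] H))
    (u v : κ → H) (p q : κ' → H) (z : κ × κ') (x : Ξ) : ℂ :=
  ⟪repCoeff U (u z.1) ((R : H →L[ℂ] H) (q z.2)) x,
    repCoeff U (v z.1) ((R : H →L[ℂ] H) (p z.2)) x⟫_ℂ

/-- With `C = α_x(β_-(B))`, the operator `A C` is the sum of the `|uᵢ⟩⟨C* vᵢ|`, so its trace is `∑
⟨vᵢ, C uᵢ⟩`; expanding `C` gives the double series, which converges absolutely. -/
theorem IsNuclearSum.hasSum_opConv {u v : κ → H} {p q : κ' → H} {A B : H →L[ℂ] H}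
    (hA : IsNuclearSum u v A) (hB : IsNuclearSum p q B) (b : HilbertBasis ι ℂ H)
    (U : Ξ → unitary (H →L[ℂ] H)) (R : unitary (H →L[ℂ] H)) (x : Ξ) :
    HasSum (fun z => convTerm U R u v p q z x) (opConv b U R A B x) := by
  have hbd : ∀ ψ φ : H, ‖repCoeff U ψ ((R : H →L[ℂ] H) φ) x‖ₑ ≤ ‖ψ‖ₑ * ‖φ‖ₑ := by
    intro ψ φ
    rw [← enorm_unitary_apply R φ, ← enorm_unitary_apply (U x) ((R : H →L[ℂ] H) φ), ← ofReal_norm, ← ofReal_norm,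
      ← ofReal_norm, ← ENNReal.ofReal_mul (norm_nonneg _)]
    exact ENNReal.ofReal_le_ofReal (norm_inner_le_norm _ _)
  have hs : Summable fun z => convTerm U R u v p q z x := by
    refine Summable.of_enorm (ne_of_lt ?_)
    refine lt_of_le_of_lt (ENNReal.tsum_le_tsum (g := fun z : κ × κ' =>
      (‖u z.1‖ₑ * ‖v z.1‖ₑ) * (‖p z.2‖ₑ * ‖q z.2‖ₑ)) fun z => ?_) ?_
    · rw [convTerm, RCLike.inner_apply', enorm_mul, RCLike.enorm_conj]
      refine (mul_le_mul' (hbd _ _) (hbd _ _)).trans_eq ?_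
      ring
    · rw [ENNReal.tsum_prod']
      simp_rw [ENNReal.tsum_mul_left, ENNReal.tsum_mul_right]
      exact ENNReal.mul_lt_top hA.tsum_lt_top hB.tsum_lt_top
  have h1 := hs.hasSum.prod_fiberwise
    (g := fun i => ⟪v i, opShift U x (opReflect R B) (u i)⟫_ℂ) fun i => by
      simpa only [convTerm, RCLike.inner_apply', repCoeff, inner_conj_symm] using
        (hB.opShift_opReflect U R x).hasSum_inner (u i) (v i)
  have h2 := (hA.mul_right (opShift U x (opReflect R B))).hasSum_opTrace b
  simp_rw [ContinuousLinearMap.star_eq_adjoint, ContinuousLinearMap.adjoint_inner_left] at h2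
  rw [opConv, h2.unique h1]
  exact hs.hasSum

variable [AddCommGroup Ξ] [MeasurableSpace Ξ] [MeasurableAdd Ξ] [MeasurableNeg Ξ]
  {m : Ξ → Ξ → Circle} {U : Ξ → unitary (H →L[ℂ] H)} {μ : Measure Ξ} [μ.IsAddRightInvariant]
  [μ.IsNegInvariant]

theorem IsProjectiveRep.tsum_lintegral_convTerm_le (hU : IsProjectiveRep m U)
    (hirr : IsIrreducibleRep U) (hμ : IsNormalizedFor μ U) (R : unitary (H →L[ℂ] H))
    (u v : κ → H) (p q : κ' → H) :
    ∑' z, ∫⁻ x, ‖convTerm U R u v p q z x‖ₑ ∂μ ≤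
      (∑' i, ‖u i‖ₑ * ‖v i‖ₑ) * ∑' k, ‖p k‖ₑ * ‖q k‖ₑ := by
  refine (ENNReal.tsum_le_tsum (g := fun z : κ × κ' =>
      (‖u z.1‖ₑ * ‖v z.1‖ₑ) * (‖p z.2‖ₑ * ‖q z.2‖ₑ)) fun z => ?_).trans_eq ?_
  · simp_rw [convTerm, RCLike.inner_apply', enorm_mul, RCLike.enorm_conj]
    refine (hU.lintegral_mul_le hirr hμ _ _ _ _).trans_eq ?_
    rw [enorm_unitary_apply, enorm_unitary_apply]
    ring
  · rw [ENNReal.tsum_prod']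
    simp_rw [ENNReal.tsum_mul_left, ENNReal.tsum_mul_right]

theorem IsProjectiveRep.opConv_of_isNuclearSum [Countable κ] [Countable κ']
    (hU : IsProjectiveRep m U) (hirr : IsIrreducibleRep U) (hμ : IsNormalizedFor μ U)
    (R : unitary (H →L[ℂ] H)) (b : HilbertBasis ι ℂ H) {u v : κ → H} {p q : κ' → H}
    {A B : H →L[ℂ] H} (hA : IsNuclearSum u v A) (hB : IsNuclearSum p q B) :
    AEStronglyMeasurable (opConv b U R A B) μ ∧
    eLpNorm (opConv b U R A B) 1 μ ≤
      (∑' i, ‖u i‖ₑ * ‖v i‖ₑ) * ∑' k, ‖p k‖ₑ * ‖q k‖ₑ ∧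
    ∫ x, opConv b U R A B x ∂μ = opTrace b A * opTrace b B := by
  have hsum := hA.hasSum_opConv hB b U R
  have hint : ∀ z, Integrable (convTerm U R u v p q z) μ := fun z =>
    hU.integrable_inner hirr hμ _ _ _ _
  have hle := hU.tsum_lintegral_convTerm_le hirr hμ R u v p q
  -- Countability of the index set makes `atTop` on its finite subsets countably generated, so the
  -- limit of the partial sums is measurable.
  refine ⟨aestronglyMeasurable_of_tendsto_ae Filter.atTop
      (f := fun s : Finset (κ × κ') => fun x => ∑ z ∈ s, convTerm U R u v p q z x)
      (fun s => (integrable_finsetSum s fun z _ => hint z).aestronglyMeasurable)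
      (Filter.Eventually.of_forall hsum), ?_, ?_⟩
  · rw [eLpNorm_one_eq_lintegral_enorm]
    refine le_trans ?_ hle
    rw [← lintegral_tsum fun z => (hint z).aestronglyMeasurable.enorm]
    refine lintegral_mono fun x => ?_
    rw [← (hsum x).tsum_eq]
    exact enorm_tsum_le_tsum_enorm
  · simp_rw [← (hsum _).tsum_eq]
    rw [integral_tsum (fun z => (hint z).aestronglyMeasurable)
      (hle.trans_lt (ENNReal.mul_lt_top hA.tsum_lt_top hB.tsum_lt_top)).ne,
      ← (hA.hasSum_opTrace b).tsum_eq, ← (hB.hasSum_opTrace b).tsum_eq,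
      tsum_mul_tsum_of_summable_norm hA.summable_norm_inner hB.summable_norm_inner]
    refine tsum_congr fun z => ?_
    simp_rw [convTerm]
    rw [hU.integral_inner hirr hμ, unitary_inner_map_map]

end Convolution

/-- Commutativity of `Ξ` makes the regular Haar measure right invariant and invariant under `x ↦
-x`, as the orthogonality relations require. -/
theorem mainTheorem7
    {Ξ : Type*} [AddCommGroup Ξ] [TopologicalSpace Ξ] [IsTopologicalAddGroup Ξ]
    [LocallyCompactSpace Ξ] [T2Space Ξ] [MeasurableSpace Ξ] [BorelSpace Ξ]
    (m : Ξ → Ξ → Circle) (hm : IsHeisenbergMultiplier m)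
    (hm_neg : ∀ x y, m (-x) (-y) = m x y)
    {H : Type*} [NormedAddCommGroup H] [InnerProductSpace ℂ H] [CompleteSpace H]
    (U : Ξ → unitary (H →L[ℂ] H)) (hU : IsProjectiveRep m U) (hirr : IsIrreducibleRep U)
    (μ : Measure Ξ) [μ.IsAddHaarMeasure] [μ.Regular]
    (hsq : IsSquareIntegrableRep U μ) (hμ : IsNormalizedFor μ U)
    (R : unitary (H →L[ℂ] H))
    (hR : ∀ x, (U x : H →L[ℂ] H) * (R : H →L[ℂ] H) = (R : H →L[ℂ] H) * (U (-x) : H →L[ℂ] H))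
    {ι : Type*} (b : HilbertBasis ι ℂ H)
    (A B : H →L[ℂ] H) (hA : IsTraceClass b A) (hB : IsTraceClass b B) :
    (∀ x, IsTraceClass b (A * opShift U x (opReflect R B))) ∧
    MemLp (opConv b U R A B) 1 μ ∧
    eLpNorm (opConv b U R A B) 1 μ ≤ traceNorm b A * traceNorm b B ∧
    ∫ x, opConv b U R A B x ∂μ = opTrace b A * opTrace b B := by
  obtain ⟨s, hs, u, v, hA', hAle⟩ := hA.exists_isNuclearSum
  obtain ⟨t, ht, p, q, hB', hBle⟩ := hB.exists_isNuclearSum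
  have := hs.to_subtype
  have := ht.to_subtype
  obtain ⟨h1, h2, h3⟩ := hU.opConv_of_isNuclearSum hirr hμ R b hA' hB'
  have h4 := h2.trans (mul_le_mul' hAle hBle)
  exact ⟨fun x => (hA'.mul_right _).isTraceClass b,
    ⟨h1, h4.trans_lt (ENNReal.mul_lt_top hA hB)⟩, h4, h3⟩
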